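/- For an irrational real number $\xi$ let $D(\xi)=\{m+n\xi : m,n\in\mathbb Z\}\subseteq\mathbb R$, with the addition and the order inherited from $\mathbb R$. Let the language of ordered groups be $\{+,-,0,\le\}$ and the language of lattice-ordered groups ($\ell$-groups) be $\{+,-,0,\vee,\wedge\}$; both are countable. (a) For every irrational $\xi$, $D(\xi)=\mathbb Z\oplus\mathbb Z\xi$ (each element is $m+n\xi$ for exactly one pair of integers $(m,n)$), the group $D(\xi)$ is generated by the two elements $1$ and $\xi$, it is dense in $\mathbb R$, and it is a densely and totally ordered abelian group. (b) For all irrational $\xi$ and $\eta$, $D(\xi)$ and $D(\eta)$ are elementarily equivalent, both in the language of ordered groups and in the language of $\ell$-groups. (c) Up to isomorphism, the $D(\xi)$ form an uncountable family: there is an uncountable set $X$ of irrational numbers such that for distinct $\xi,\eta\in X$ the groups $D(\xi)$ and $D(\eta)$ are isomorphic neither as ordered groups nor as $\ell$-groups, while for each irrational $\eta$ the ordered group $D(\eta)$ is isomorphic to $D(\xi)$ for some $\xi\in X$. (d) Consequently, it is not true that any two finitely generated abelian $\ell$-groups which satisfy the same first-order sentences in the language of $\ell$-groups are isomorphic. 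-/

import Mathlib

namespace OrderedGroups

/-- The function symbols `+, -, 0` of the language of ordered groups (written additively). -/
inductive OGroupFunc : ℕ → Type
  | add : OGroupFunc 2
  | neg : OGroupFunc 1
  | zero : OGroupFunc 0

/-- The relation symbol `≤` of the language of ordered groups. -/
inductive OGroupRel : ℕ → Type
  | le : OGroupRel 2

/-- The first-order language `{+, -, 0, ≤}` of (totally) ordered groups. -/
def ogroupLang : FirstOrder.Language.{0, 0} := ⟨OGroupFunc, OGroupRel⟩

/-- An ordered group as a structure for the language of ordered groups. -/
instance ogroupStructure (G : Type*) [AddGroup G] [LE G] : ogroupLang.Structure G where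
  funMap := fun f x =>
    match f, x with
    | OGroupFunc.add, x => x 0 + x 1
    | OGroupFunc.neg, x => -x 0
    | OGroupFunc.zero, _ => 0
  RelMap := fun r x =>
    match r, x with
    | OGroupRel.le, x => x 0 ≤ x 1

/-- The function symbols `+, -, 0, ∨, ∧` of the language of lattice-ordered groups. -/
inductive LGroupFunc : ℕ → Type
  | add : LGroupFunc 2
  | neg : LGroupFunc 1
  | zero : LGroupFunc 0
  | sup : LGroupFunc 2
  | inf : LGroupFunc 2

/-- The first-order language `{+, -, 0, ∨, ∧}` of lattice-ordered groups; it has no relation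
symbol besides equality. -/
def lgroupLang : FirstOrder.Language.{0, 0} := ⟨LGroupFunc, fun _ => Empty⟩

/-- A lattice-ordered group as a structure for the language of lattice-ordered groups. -/
instance lgroupStructure (G : Type*) [AddGroup G] [Lattice G] : lgroupLang.Structure G where
  funMap := fun f x =>
    match f, x with
    | LGroupFunc.add, x => x 0 + x 1
    | LGroupFunc.neg, x => -x 0
    | LGroupFunc.zero, _ => 0
    | LGroupFunc.sup, x => x 0 ⊔ x 1
    | LGroupFunc.inf, x => x 0 ⊓ x 1
  RelMap := fun r _ => r.elim

/-- The subgroup `D(ξ) = ℤ + ℤξ` of `ℝ`. Its elements carry the order inherited from `ℝ`. -/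
def D (ξ : ℝ) : AddSubgroup ℝ where
  carrier := {x | ∃ m n : ℤ, x = m + n * ξ}
  zero_mem' := ⟨0, 0, by simp⟩
  add_mem' := by
    rintro _ _ ⟨m, n, rfl⟩ ⟨k, l, rfl⟩
    exact ⟨m + k, n + l, by push_cast; ring⟩
  neg_mem' := by
    rintro _ ⟨m, n, rfl⟩
    exact ⟨-m, -n, by push_cast; ring⟩

end OrderedGroups

/-! For irrational ξ, the coordinates (m, n) identify D(ξ) with ℤ × ℤ; only the order depends on ξ.
Elementary equivalence comes from a back-and-forth between tuples in D(ξ) and D(η) that agree to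
finite precision: integer combinations with coefficients at most N have equal signs (`SameSigns`),
and entries are congruent modulo M (`CongrMod`), since divisibility by an integer is first-order
definable. `exists_extension` adds a point at the price of larger N and M: either a small linear
relation forces the new point, and the congruences permit the division, or the point only has to lie
in an open interval and a residue class, which density allows. Induction on formulas
(`exists_bound_realize_iff`) gives each formula its own precision; for sentences the tuples are
empty.

An isomorphism of ordered groups from D(ξ) to D(η) preserves the rational cut of ξ, so ξ is a ratio
of two elements of the countable group D(η) (`gen_eq_div`). Isomorphism classes are therefore
countable, and the irrationals split into uncountably many of them. Two representatives give the
counterexample in (d). -/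

namespace OrderedGroups

open FirstOrder FirstOrder.Language

/-! ### Coordinates and density -/

/-- The parametrisation `(m, n) ↦ m + n ξ` of `D ξ`, as a map to `ℝ`. -/
noncomputable def eval (ξ : ℝ) : ℤ × ℤ →+ ℝ where
  toFun p := p.1 + p.2 * ξ
  map_zero' := by simp
  map_add' p q := by simp; ring

theorem eval_apply (ξ : ℝ) (p : ℤ × ℤ) : eval ξ p = p.1 + p.2 * ξ := rfl

theorem eval_smul (ξ : ℝ) (k : ℤ) (p : ℤ × ℤ) : eval ξ (k • p) = k * eval ξ p := by
  rw [map_zsmul, zsmul_eq_mul]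

theorem eval_injective {ξ : ℝ} (hξ : Irrational ξ) : Function.Injective (eval ξ) := by
  rw [injective_iff_map_eq_zero]
  rintro ⟨m, n⟩ h
  rw [eval_apply] at h
  simp only at h
  have hn : n = 0 := by
    by_contra hn
    exact ((hξ.intCast_mul hn).intCast_add m).ne_zero h
  subst hn
  simp at h
  simp [h]

/-- The parametrisation `(m, n) ↦ m + n ξ` of `D ξ`. -/
noncomputable def param (ξ : ℝ) : ℤ × ℤ →+ D ξ where
  toFun p := ⟨eval ξ p, p.1, p.2, rfl⟩
  map_zero' := by ext; simp
  map_add' p q := by ext; simp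

@[simp] theorem coe_param (ξ : ℝ) (p : ℤ × ℤ) : (param ξ p : ℝ) = eval ξ p := rfl

theorem param_surjective (ξ : ℝ) : Function.Surjective (param ξ) := by
  rintro ⟨_, m, n, rfl⟩
  exact ⟨(m, n), rfl⟩

theorem closure_eq (ξ : ℝ) : AddSubgroup.closure {1, ξ} = D ξ := by
  ext x
  rw [AddSubgroup.mem_closure_pair]
  constructor
  · rintro ⟨m, n, rfl⟩
    exact ⟨m, n, by simp⟩
  · rintro ⟨m, n, rfl⟩
    exact ⟨m, n, by simp⟩

theorem dense_D {ξ : ℝ} (hξ : Irrational ξ) : Dense (D ξ : Set ℝ) := by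
  rw [← closure_eq, Set.pair_comm, dense_addSubgroupClosure_pair_iff]
  simpa using hξ

/-- Translating and scaling a dense subgroup keeps it dense, so each residue class modulo M meets
every open interval. -/
theorem exists_eval_mem_Ioo {ξ : ℝ} (hξ : Irrational ξ) (p : ℤ × ℤ) {M : ℤ} (hM : 0 < M)
    {l u : ℝ} (h : l < u) : ∃ z : ℤ × ℤ, l < eval ξ (p + M • z) ∧ eval ξ (p + M • z) < u := by
  have hM' : (0 : ℝ) < M := by exact_mod_cast hM
  have h' : (l - eval ξ p) / M < (u - eval ξ p) / M := by gcongr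
  obtain ⟨w, ⟨m, n, rfl⟩, h1, h2⟩ := (dense_D hξ).exists_between h'
  refine ⟨(m, n), ?_⟩
  rw [div_lt_iff₀ hM'] at h1
  rw [lt_div_iff₀ hM'] at h2
  rw [map_add, map_zsmul, eval_apply ξ (m, n), zsmul_eq_mul]
  constructor <;> simp only <;> nlinarith

/-! ### Finite-precision agreement of tuples -/

/-- The integer linear combination of the tuple `x` with coefficients `c`. -/
def lin {n : ℕ} (x : Fin n → ℤ × ℤ) : (Fin n → ℤ) →+ ℤ × ℤ where
  toFun c := ∑ i, c i • x i
  map_zero' := by simp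
  map_add' c d := by simp [add_smul, Finset.sum_add_distrib]

theorem lin_apply {n : ℕ} (x : Fin n → ℤ × ℤ) (c : Fin n → ℤ) : lin x c = ∑ i, c i • x i := rfl

theorem lin_snoc {n : ℕ} (x : Fin n → ℤ × ℤ) (p : ℤ × ℤ) (c : Fin (n + 1) → ℤ) :
    lin (Fin.snoc x p : Fin (n + 1) → ℤ × ℤ) c = lin x (fun i => c i.castSucc) + c (Fin.last n) • p := by
  simp [lin_apply, Fin.sum_univ_castSucc]

/-- All integer combinations with coefficients bounded by `N` have the same sign at `x`, computed
in `D ξ`, as at `y`, computed in `D η`. -/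
def SameSigns (ξ η : ℝ) (N : ℤ) {n : ℕ} (x y : Fin n → ℤ × ℤ) : Prop :=
  ∀ c : Fin n → ℤ, (∀ i, |c i| ≤ N) →
    SignType.sign (eval ξ (lin x c)) = SignType.sign (eval η (lin y c))

/-- The tuples `x` and `y` agree modulo `M`. -/
def CongrMod (M : ℤ) {n : ℕ} (x y : Fin n → ℤ × ℤ) : Prop :=
  ∀ i, ∃ z : ℤ × ℤ, y i = x i + M • z

variable {ξ η : ℝ} {N N' M M' : ℤ} {n : ℕ} {x y : Fin n → ℤ × ℤ}

theorem SameSigns.mono (h : SameSigns ξ η N x y) (hN : N' ≤ N) : SameSigns ξ η N' x y :=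
  fun c hc => h c fun i => (hc i).trans hN

theorem SameSigns.symm (h : SameSigns ξ η N x y) : SameSigns η ξ N y x :=
  fun c hc => (h c hc).symm

theorem CongrMod.of_dvd (h : CongrMod M x y) (hM : M' ∣ M) : CongrMod M' x y := by
  obtain ⟨k, rfl⟩ := hM
  intro i
  obtain ⟨z, hz⟩ := h i
  exact ⟨k • z, by rw [hz, mul_smul]⟩

theorem CongrMod.symm (h : CongrMod M x y) : CongrMod M y x := by
  intro i
  obtain ⟨z, hz⟩ := h i
  exact ⟨-z, by rw [hz]; simp⟩

theorem CongrMod.lin (h : CongrMod M x y) (c : Fin n → ℤ) :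
    ∃ z : ℤ × ℤ, lin y c = lin x c + M • z := by
  choose z hz using h
  refine ⟨∑ i, c i • z i, ?_⟩
  simp only [lin_apply, hz, smul_add, Finset.sum_add_distrib, Finset.smul_sum]
  congr 1
  exact Finset.sum_congr rfl fun i _ => smul_comm _ _ _

theorem abs_mul_sub_mul_le {a b c d : ℤ} (ha : |a| ≤ N) (hb : |b| ≤ N) (hc : |c| ≤ N)
    (hd : |d| ≤ N) : |a * b - c * d| ≤ 2 * N ^ 2 := by
  have hN : 0 ≤ N := (abs_nonneg a).trans ha
  have h1 : |a * b| ≤ N * N := by rw [abs_mul]; gcongr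
  have h2 : |c * d| ≤ N * N := by rw [abs_mul]; gcongr
  linarith [abs_sub (a * b) (c * d)]

theorem CongrMod.snoc (h : CongrMod M x y) (p z : ℤ × ℤ) :
    CongrMod M (Fin.snoc x p : Fin (n + 1) → ℤ × ℤ)
      (Fin.snoc y (p + M • z) : Fin (n + 1) → ℤ × ℤ) := by
  intro i
  refine Fin.lastCases ⟨z, by simp⟩ (fun j => ?_) i
  simpa using h j

theorem sign_neg_congr {a b : ℝ} (h : SignType.sign (-a) = SignType.sign (-b)) :
    SignType.sign a = SignType.sign b := by
  simpa [Left.sign_neg] using h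

/-- It suffices to compare the signs of combinations in which the new coefficient is positive. -/
theorem SameSigns.snoc (h : SameSigns ξ η N x y) {p q : ℤ × ℤ}
    (hpq : ∀ (c : Fin n → ℤ) (k : ℤ), (∀ i, |c i| ≤ N) → 0 < k → k ≤ N →
      SignType.sign (eval ξ (OrderedGroups.lin x c) + k * eval ξ p) =
        SignType.sign (eval η (OrderedGroups.lin y c) + k * eval η q)) :
    SameSigns ξ η N (Fin.snoc x p : Fin (n + 1) → ℤ × ℤ)
      (Fin.snoc y q : Fin (n + 1) → ℤ × ℤ) := by
  intro c hc
  rw [lin_snoc, lin_snoc, map_add (eval ξ), map_add (eval η), eval_smul, eval_smul]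
  set d : Fin n → ℤ := fun i => c i.castSucc with hd
  have hdN : ∀ i, |d i| ≤ N := fun i => hc _
  have hk := hc (Fin.last n)
  set k := c (Fin.last n)
  rcases lt_trichotomy k 0 with hk0 | hk0 | hk0
  · apply sign_neg_congr
    have := hpq (-d) (-k) (fun i => by simpa using hdN i) (by linarith)
      ((neg_le_abs k).trans hk)
    simp only [map_neg] at this
    convert this using 2 <;> push_cast <;> ring
  · simpa [hk0] using h d hdN
  · exact hpq d k hdN hk0 ((le_abs_self k).trans hk)

theorem sign_pos_mul {k : ℝ} (hk : 0 < k) (a : ℝ) :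
    SignType.sign (k * a) = SignType.sign a := by
  rw [sign_mul, sign_pos hk, one_mul]

/-! ### Back-and-forth -/

/-- The extension step of the back-and-forth argument. -/
theorem exists_extension (hξ : Irrational ξ) (hη : Irrational η) (N : ℕ) (hM : 0 < M)
    (hs : SameSigns ξ η (2 * (N : ℤ) ^ 2 + N) x y) (hc : CongrMod (M * (N.factorial : ℤ)) x y)
    (p : ℤ × ℤ) :
    ∃ q : ℤ × ℤ,
      SameSigns ξ η N (Fin.snoc x p : Fin (n + 1) → ℤ × ℤ)
        (Fin.snoc y q : Fin (n + 1) → ℤ × ℤ) ∧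
      CongrMod M (Fin.snoc x p : Fin (n + 1) → ℤ × ℤ)
        (Fin.snoc y q : Fin (n + 1) → ℤ × ℤ) := by
  have hs' : SameSigns ξ η N x y := hs.mono (by nlinarith)
  have hc' : CongrMod M x y := hc.of_dvd (dvd_mul_right _ _)
  -- Eliminating the new point from c + k·p and d + l·p leaves k·c - l·d, with coefficients at most
  -- 2N²; hence the bound in `hs`.
  have key : ∀ (c d : Fin n → ℤ) (k l : ℤ), (∀ i, |c i| ≤ N) → (∀ i, |d i| ≤ N) →
      0 < k → k ≤ N → 0 < l → l ≤ N →
      SignType.sign (k * eval ξ (lin x c) - l * eval ξ (lin x d)) =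
        SignType.sign (k * eval η (lin y c) - l * eval η (lin y d)) := by
    intro c d k l hc hd hk hkN hl hlN
    have := hs (k • c - l • d) fun i => by
      have := abs_mul_sub_mul_le (a := k) (c := l) (by rwa [abs_of_pos hk]) (hc i)
        (by rwa [abs_of_pos hl]) (hd i)
      simp only [Pi.sub_apply, Pi.smul_apply, smul_eq_mul]
      linarith
    simpa only [map_sub, map_zsmul (lin x), map_zsmul (lin y), eval_smul] using this
  by_cases hzero : ∃ (d : Fin n → ℤ) (k : ℤ), (∀ i, |d i| ≤ N) ∧ 0 < k ∧ k ≤ N ∧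
      lin x d + k • p = 0
  · obtain ⟨d, k, hd, hk, hkN, h0⟩ := hzero
    have hk' : (0 : ℝ) < k := by exact_mod_cast hk
    have hdvd : k ∣ (N.factorial : ℤ) := by
      lift k to ℕ using hk.le
      exact_mod_cast Nat.dvd_factorial (by exact_mod_cast hk) (by exact_mod_cast hkN)
    obtain ⟨f, hf⟩ := hdvd
    obtain ⟨z, hz⟩ := hc.lin d
    -- The relation forces q = -(lin y d)/k. As k divides N!, congruence modulo M·N! makes this
    -- quotient integral and congruent to p modulo M.
    have h0' : lin y d + k • (p + M • (-(f • z))) = 0 := by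
      rw [hz, hf]
      have : lin x d = -(k • p) := eq_neg_of_add_eq_zero_left h0
      rw [this]
      module
    refine ⟨p + M • (-(f • z)), hs'.snoc ?_, hc'.snoc _ _⟩
    generalize p + M • (-(f • z)) = q at h0'
    intro c l hcN hl hlN
    have e1 : eval ξ (lin x d) + k * eval ξ p = 0 := by
      simpa only [map_add, eval_smul, map_zero] using congrArg (eval ξ) h0
    have e2 : eval η (lin y d) + k * eval η q = 0 := by
      simpa only [map_add, eval_smul, map_zero] using congrArg (eval η) h0'
    rw [← sign_pos_mul hk', ← sign_pos_mul hk' (eval η (lin y c) + l * eval η q)]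
    convert key c d k l hcN hd hk hkN hl hlN using 2
    · linear_combination (l : ℝ) * e1
    · linear_combination (l : ℝ) * e2
  · push Not at hzero
    -- No small combination involving p vanishes, so q has only to satisfy finitely many strict
    -- inequalities: `L` collects the lower bounds for its value, `U` the upper ones.
    let F : Finset ((Fin n → ℤ) × ℤ) :=
      (Fintype.piFinset fun _ => Finset.Icc (-(N : ℤ)) N) ×ˢ Finset.Icc 1 (N : ℤ)
    have hF : ∀ r : (Fin n → ℤ) × ℤ, r ∈ F ↔ (∀ i, |r.1 i| ≤ N) ∧ 0 < r.2 ∧ r.2 ≤ N := by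
      intro r
      simp only [F, abs_le, Finset.mem_product, Fintype.mem_piFinset, Finset.mem_Icc,
        Int.lt_iff_add_one_le, zero_add]
    let s : (Fin n → ℤ) × ℤ → ℝ := fun r => eval ξ (lin x r.1) + r.2 * eval ξ p
    let b : (Fin n → ℤ) × ℤ → ℝ := fun r => -eval η (lin y r.1) / r.2
    classical
    let L : Finset ℝ := (F.filter fun r => 0 < s r).image b
    let U : Finset ℝ := (F.filter fun r => s r < 0).image b
    have hLU : ∀ l ∈ L, ∀ u ∈ U, l < u := by
      intro l hl u hu
      simp only [L, U, Finset.mem_image, Finset.mem_filter, hF] at hl hu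
      obtain ⟨⟨c, k⟩, ⟨⟨hc, hk, hkN⟩, h1⟩, rfl⟩ := hl
      obtain ⟨⟨d, l⟩, ⟨⟨hd, hl, hlN⟩, h2⟩, rfl⟩ := hu
      have hk' : (0 : ℝ) < k := by exact_mod_cast hk
      have hl' : (0 : ℝ) < l := by exact_mod_cast hl
      simp only [s, b] at *
      have := key d c k l hd hc hk hkN hl hlN
      have hneg : k * eval ξ (lin x d) - l * eval ξ (lin x c) < 0 := by
        have h3 := mul_neg_of_pos_of_neg hk' h2
        have h4 := mul_pos hl' h1
        nlinarith
      rw [sign_neg hneg, eq_comm, sign_eq_neg_one_iff] at this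
      rw [div_lt_div_iff₀ hk' hl']
      linarith
    obtain ⟨l, hl1, hl2⟩ := Finset.exists_between' L U hLU
    -- A second separation, with l added to the lower bounds, yields a nonempty interval (l, u) even
    -- if `L` or `U` is empty.
    obtain ⟨u, hu1, hu2⟩ := Finset.exists_between' (insert l L) U (by
      intro a ha b hb
      rcases Finset.mem_insert.1 ha with rfl | ha
      · exact hl2 b hb
      · exact hLU a ha b hb)
    obtain ⟨z, hz1, hz2⟩ := exists_eval_mem_Ioo hη p hM (hu1 l (Finset.mem_insert_self _ _))
    refine ⟨p + M • z, hs'.snoc ?_, hc'.snoc _ _⟩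
    generalize p + M • z = q at hz1 hz2
    intro c k hcN hk hkN
    have hk' : (0 : ℝ) < k := by exact_mod_cast hk
    have hmem : (c, k) ∈ F := (hF _).2 ⟨hcN, hk, hkN⟩
    rcases lt_trichotomy (s (c, k)) 0 with h | h | h
    · have hb : b (c, k) ∈ U := Finset.mem_image_of_mem _ (by simp [hmem, h])
      have := hz2.trans (hu2 _ hb)
      simp only [b, lt_div_iff₀ hk'] at this
      rw [sign_neg h, sign_neg (by linarith)]
    · refine absurd (eval_injective hξ ?_) (hzero c k hcN hk hkN)
      rwa [map_add, eval_smul, map_zero]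
    · have hb : b (c, k) ∈ L := Finset.mem_image_of_mem _ (by simp [hmem, h])
      have := (hl1 _ hb).trans hz1
      simp only [b, div_lt_iff₀ hk'] at this
      rw [sign_pos h, sign_pos (by linarith)]

/-! ### From terms to sentences -/

/-- On tuples with the same signs, the term `t` is given by the same integer combination. -/
def TermLinear (L : FirstOrder.Language.{0, 0}) (ξ η : ℝ) [L.Structure (D ξ)] [L.Structure (D η)] {n : ℕ}
    (t : L.Term (Empty ⊕ Fin n)) : Prop :=
  ∃ N : ℕ, ∀ x y : Fin n → ℤ × ℤ, SameSigns ξ η N x y → ∃ c : Fin n → ℤ, (∀ i, |c i| ≤ N) ∧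
    t.realize (Sum.elim default (param ξ ∘ x)) = param ξ (lin x c) ∧
    t.realize (Sum.elim default (param η ∘ y)) = param η (lin y c)

theorem termLinear_var (L : FirstOrder.Language.{0, 0}) [L.Structure (D ξ)] [L.Structure (D η)]
    (v : Empty ⊕ Fin n) : TermLinear L ξ η (Term.var v : L.Term (Empty ⊕ Fin n)) := by
  rcases v with v | i
  · exact v.elim
  · refine ⟨1, fun x y _ => ⟨Pi.single i 1, fun j => ?_, ?_, ?_⟩⟩
    · by_cases h : j = i
      · subst h; simp
      · simp [h]
    · simp [lin_apply, Pi.single_apply, ite_smul]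
    · simp [lin_apply, Pi.single_apply, ite_smul]

theorem SameSigns.sub_sign {c d : Fin n → ℤ} {N₁ N₂ : ℕ}
    (h : SameSigns ξ η ((N₁ + N₂ : ℕ) : ℤ) x y) (hc : ∀ i, |c i| ≤ N₁) (hd : ∀ i, |d i| ≤ N₂) :
    SignType.sign (eval ξ (OrderedGroups.lin x c) - eval ξ (OrderedGroups.lin x d)) =
      SignType.sign (eval η (OrderedGroups.lin y c) - eval η (OrderedGroups.lin y d)) := by
  have := h (c - d) fun i => by
    have := abs_sub (c i) (d i)
    have h1 := hc i
    have h2 := hd i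
    simp only [Pi.sub_apply]
    push_cast
    linarith
  simpa only [map_sub] using this

theorem SameSigns.le_iff {c d : Fin n → ℤ} {N₁ N₂ : ℕ}
    (h : SameSigns ξ η ((N₁ + N₂ : ℕ) : ℤ) x y) (hc : ∀ i, |c i| ≤ N₁) (hd : ∀ i, |d i| ≤ N₂) :
    param ξ (OrderedGroups.lin x c) ≤ param ξ (OrderedGroups.lin x d) ↔
      param η (OrderedGroups.lin y c) ≤ param η (OrderedGroups.lin y d) := by
  rw [← Subtype.coe_le_coe, ← Subtype.coe_le_coe, coe_param, coe_param, coe_param, coe_param,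
    ← sub_nonpos, ← sub_nonpos (a := eval η _), ← sign_nonpos_iff, h.sub_sign hc hd,
    sign_nonpos_iff]

theorem SameSigns.eq_iff {c d : Fin n → ℤ} {N₁ N₂ : ℕ}
    (h : SameSigns ξ η ((N₁ + N₂ : ℕ) : ℤ) x y) (hc : ∀ i, |c i| ≤ N₁) (hd : ∀ i, |d i| ≤ N₂) :
    param ξ (OrderedGroups.lin x c) = param ξ (OrderedGroups.lin x d) ↔
      param η (OrderedGroups.lin y c) = param η (OrderedGroups.lin y d) := by
  have h' : SameSigns ξ η ((N₂ + N₁ : ℕ) : ℤ) x y := by rwa [add_comm]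
  rw [le_antisymm_iff, le_antisymm_iff, h.le_iff hc hd, h'.le_iff hd hc]

theorem SameSigns.left {N₁ N₂ : ℕ} (h : SameSigns ξ η ((N₁ + N₂ : ℕ) : ℤ) x y) :
    SameSigns ξ η N₁ x y := h.mono (by push_cast; linarith)

theorem SameSigns.right {N₁ N₂ : ℕ} (h : SameSigns ξ η ((N₁ + N₂ : ℕ) : ℤ) x y) :
    SameSigns ξ η N₂ x y := h.mono (by push_cast; linarith)

/-- If terms are linear and relation symbols are determined by signs of integer combinations,
then so are all formulas. -/
theorem exists_bound_realize_iff {L : FirstOrder.Language.{0, 0}} [L.Structure (D ξ)] [L.Structure (D η)]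
    (hξ : Irrational ξ) (hη : Irrational η)
    (hterm : ∀ {n : ℕ} (t : L.Term (Empty ⊕ Fin n)), TermLinear L ξ η t)
    (hrel : ∀ {n l : ℕ} (R : L.Relations l) (ts : Fin l → L.Term (Empty ⊕ Fin n)),
      ∃ N : ℕ, ∀ x y : Fin n → ℤ × ℤ, SameSigns ξ η N x y →
        (Structure.RelMap R (fun i => (ts i).realize (Sum.elim default (param ξ ∘ x))) ↔
          Structure.RelMap R (fun i => (ts i).realize (Sum.elim default (param η ∘ y)))))
    {n : ℕ} (φ : L.BoundedFormula Empty n) :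
    ∃ (N : ℕ) (M : ℤ), 0 < M ∧ ∀ x y : Fin n → ℤ × ℤ, SameSigns ξ η N x y → CongrMod M x y →
      (φ.Realize default (param ξ ∘ x) ↔ φ.Realize default (param η ∘ y)) := by
  induction φ with
  | falsum => exact ⟨0, 1, one_pos, fun _ _ _ _ => Iff.rfl⟩
  | equal t₁ t₂ =>
    obtain ⟨N₁, h₁⟩ := hterm t₁
    obtain ⟨N₂, h₂⟩ := hterm t₂
    refine ⟨N₁ + N₂, 1, one_pos, fun x y hs _ => ?_⟩
    obtain ⟨c, hc, hc1, hc2⟩ := h₁ x y hs.left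
    obtain ⟨d, hd, hd1, hd2⟩ := h₂ x y hs.right
    simp only [BoundedFormula.Realize, hc1, hc2, hd1, hd2]
    exact hs.eq_iff hc hd
  | rel R ts =>
    obtain ⟨N, h⟩ := hrel R ts
    exact ⟨N, 1, one_pos, fun x y hs _ => h x y hs⟩
  | imp φ ψ ihφ ihψ =>
    obtain ⟨N₁, M₁, hM₁, h₁⟩ := ihφ
    obtain ⟨N₂, M₂, hM₂, h₂⟩ := ihψ
    refine ⟨N₁ + N₂, M₁ * M₂, mul_pos hM₁ hM₂, fun x y hs hc => ?_⟩
    rw [BoundedFormula.realize_imp, BoundedFormula.realize_imp,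
      h₁ x y hs.left (hc.of_dvd (dvd_mul_right _ _)),
      h₂ x y hs.right (hc.of_dvd (dvd_mul_left _ _))]
  | all φ ih =>
    obtain ⟨N, M, hM, h⟩ := ih
    refine ⟨2 * N ^ 2 + N, M * N.factorial, by positivity, fun x y hs hc => ?_⟩
    push_cast at hs
    rw [BoundedFormula.realize_all, BoundedFormula.realize_all, (param_surjective ξ).forall,
      (param_surjective η).forall]
    simp only [← Fin.comp_snoc]
    constructor
    · intro H q
      obtain ⟨p, hp1, hp2⟩ := exists_extension hη hξ N hM hs.symm hc.symm q
      exact (h _ _ hp1.symm hp2.symm).1 (H p)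
    · intro H p
      obtain ⟨q, hq1, hq2⟩ := exists_extension hξ hη N hM hs hc p
      exact (h _ _ hq1 hq2).2 (H q)

theorem elementarilyEquivalent_of_termLinear {L : FirstOrder.Language.{0, 0}} [L.Structure (D ξ)]
    [L.Structure (D η)] (hξ : Irrational ξ) (hη : Irrational η)
    (hterm : ∀ {n : ℕ} (t : L.Term (Empty ⊕ Fin n)), TermLinear L ξ η t)
    (hrel : ∀ {n l : ℕ} (R : L.Relations l) (ts : Fin l → L.Term (Empty ⊕ Fin n)),
      ∃ N : ℕ, ∀ x y : Fin n → ℤ × ℤ, SameSigns ξ η N x y →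
        (Structure.RelMap R (fun i => (ts i).realize (Sum.elim default (param ξ ∘ x))) ↔
          Structure.RelMap R (fun i => (ts i).realize (Sum.elim default (param η ∘ y))))) :
    L.ElementarilyEquivalent (D ξ) (D η) := by
  rw [elementarilyEquivalent_iff]
  intro φ
  obtain ⟨N, M, -, h⟩ := exists_bound_realize_iff hξ hη hterm hrel φ
  have := h default default (fun c _ => by simp [lin_apply]) (fun i => i.elim0)
  unfold Sentence.Realize Formula.Realize
  convert this using 2

theorem termLinear_ogroup (t : ogroupLang.Term (Empty ⊕ Fin n)) :
    TermLinear ogroupLang ξ η t := by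
  induction t with
  | var v => exact termLinear_var _ v
  | func f ts ih =>
    cases f with
    | add =>
      obtain ⟨N₁, h₁⟩ := ih 0
      obtain ⟨N₂, h₂⟩ := ih 1
      refine ⟨N₁ + N₂, fun x y hs => ?_⟩
      obtain ⟨c, hc, hc1, hc2⟩ := h₁ x y hs.left
      obtain ⟨d, hd, hd1, hd2⟩ := h₂ x y hs.right
      refine ⟨c + d, fun i => ?_, ?_, ?_⟩
      · push_cast
        exact (abs_add_le _ _).trans (add_le_add (hc i) (hd i))
      · rw [map_add, map_add, ← hc1, ← hd1]; rfl
      · rw [map_add, map_add, ← hc2, ← hd2]; rfl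
    | neg =>
      obtain ⟨N, h⟩ := ih 0
      refine ⟨N, fun x y hs => ?_⟩
      obtain ⟨c, hc, hc1, hc2⟩ := h x y hs
      refine ⟨-c, fun i => by simpa using hc i, ?_, ?_⟩
      · rw [map_neg, map_neg, ← hc1]; rfl
      · rw [map_neg, map_neg, ← hc2]; rfl
    | zero =>
      refine ⟨0, fun x y _ => ⟨0, by simp, ?_, ?_⟩⟩
      · rw [map_zero, map_zero]; rfl
      · rw [map_zero, map_zero]; rfl

/-- The order is total, so a supremum or infimum is one of its two arguments; the sign of their
difference decides which, identically on both sides. -/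
theorem termLinear_lgroup (t : lgroupLang.Term (Empty ⊕ Fin n)) :
    TermLinear lgroupLang ξ η t := by
  induction t with
  | var v => exact termLinear_var _ v
  | func f ts ih =>
    cases f with
    | add =>
      obtain ⟨N₁, h₁⟩ := ih 0
      obtain ⟨N₂, h₂⟩ := ih 1
      refine ⟨N₁ + N₂, fun x y hs => ?_⟩
      obtain ⟨c, hc, hc1, hc2⟩ := h₁ x y hs.left
      obtain ⟨d, hd, hd1, hd2⟩ := h₂ x y hs.right
      refine ⟨c + d, fun i => ?_, ?_, ?_⟩
      · push_cast
        exact (abs_add_le _ _).trans (add_le_add (hc i) (hd i))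
      · rw [map_add, map_add, ← hc1, ← hd1]; rfl
      · rw [map_add, map_add, ← hc2, ← hd2]; rfl
    | neg =>
      obtain ⟨N, h⟩ := ih 0
      refine ⟨N, fun x y hs => ?_⟩
      obtain ⟨c, hc, hc1, hc2⟩ := h x y hs
      refine ⟨-c, fun i => by simpa using hc i, ?_, ?_⟩
      · rw [map_neg, map_neg, ← hc1]; rfl
      · rw [map_neg, map_neg, ← hc2]; rfl
    | zero =>
      refine ⟨0, fun x y _ => ⟨0, by simp, ?_, ?_⟩⟩
      · rw [map_zero, map_zero]; rfl
      · rw [map_zero, map_zero]; rfl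
    | sup =>
      obtain ⟨N₁, h₁⟩ := ih 0
      obtain ⟨N₂, h₂⟩ := ih 1
      refine ⟨N₁ + N₂, fun x y hs => ?_⟩
      obtain ⟨c, hc, hc1, hc2⟩ := h₁ x y hs.left
      obtain ⟨d, hd, hd1, hd2⟩ := h₂ x y hs.right
      by_cases hle : param ξ (lin x c) ≤ param ξ (lin x d)
      · have hle' := (hs.le_iff hc hd).1 hle
        refine ⟨d, fun i => (hd i).trans (by simp), ?_, ?_⟩
        · rw [← sup_eq_right.2 hle, ← hc1, ← hd1]; rfl
        · rw [← sup_eq_right.2 hle', ← hc2, ← hd2]; rfl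
      · have hle' := fun h => hle ((hs.le_iff hc hd).2 h)
        refine ⟨c, fun i => (hc i).trans (by simp), ?_, ?_⟩
        · rw [← sup_eq_left.2 (le_of_not_ge hle), ← hc1, ← hd1]; rfl
        · rw [← sup_eq_left.2 (le_of_not_ge hle'), ← hc2, ← hd2]; rfl
    | inf =>
      obtain ⟨N₁, h₁⟩ := ih 0
      obtain ⟨N₂, h₂⟩ := ih 1
      refine ⟨N₁ + N₂, fun x y hs => ?_⟩
      obtain ⟨c, hc, hc1, hc2⟩ := h₁ x y hs.left
      obtain ⟨d, hd, hd1, hd2⟩ := h₂ x y hs.right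
      by_cases hle : param ξ (lin x c) ≤ param ξ (lin x d)
      · have hle' := (hs.le_iff hc hd).1 hle
        refine ⟨c, fun i => (hc i).trans (by simp), ?_, ?_⟩
        · rw [← inf_eq_left.2 hle, ← hc1, ← hd1]; rfl
        · rw [← inf_eq_left.2 hle', ← hc2, ← hd2]; rfl
      · have hle' := fun h => hle ((hs.le_iff hc hd).2 h)
        refine ⟨d, fun i => (hd i).trans (by simp), ?_, ?_⟩
        · rw [← inf_eq_right.2 (le_of_not_ge hle), ← hc1, ← hd1]; rfl
        · rw [← inf_eq_right.2 (le_of_not_ge hle'), ← hc2, ← hd2]; rfl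

theorem elementarilyEquivalent_ogroup (hξ : Irrational ξ) (hη : Irrational η) :
    ogroupLang.ElementarilyEquivalent (D ξ) (D η) := by
  refine elementarilyEquivalent_of_termLinear hξ hη termLinear_ogroup ?_
  intro n l R ts
  cases R with
  | le =>
    obtain ⟨N₁, h₁⟩ := termLinear_ogroup (ξ := ξ) (η := η) (ts 0)
    obtain ⟨N₂, h₂⟩ := termLinear_ogroup (ξ := ξ) (η := η) (ts 1)
    refine ⟨N₁ + N₂, fun x y hs => ?_⟩
    obtain ⟨c, hc, hc1, hc2⟩ := h₁ x y hs.left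
    obtain ⟨d, hd, hd1, hd2⟩ := h₂ x y hs.right
    have := hs.le_iff hc hd
    rw [← hc1, ← hc2, ← hd1, ← hd2] at this
    exact this

theorem elementarilyEquivalent_lgroup (hξ : Irrational ξ) (hη : Irrational η) :
    lgroupLang.ElementarilyEquivalent (D ξ) (D η) :=
  elementarilyEquivalent_of_termLinear hξ hη termLinear_lgroup fun R => R.elim

/-! ### Isomorphism classes -/

/-- An isomorphism of lattice-ordered groups preserves the addition and the order. -/
theorem nonempty_orderAddMonoidIso_of_lgroupEquiv {G H : Type*} [AddGroup G] [Lattice G]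
    [AddGroup H] [Lattice H] (f : lgroupLang.Equiv G H) : Nonempty (G ≃+o H) := by
  have hadd : ∀ a b, f (a + b) = f a + f b := fun a b =>
    f.map_fun (LGroupFunc.add : lgroupLang.Functions 2) ![a, b]
  have hsup : ∀ a b, f (a ⊔ b) = f a ⊔ f b := fun a b =>
    f.map_fun (LGroupFunc.sup : lgroupLang.Functions 2) ![a, b]
  refine ⟨{ toEquiv := f.toEquiv, map_add' := hadd, map_le_map_iff' := ?_ }⟩
  intro a b
  change f a ≤ f b ↔ a ≤ b
  rw [← sup_eq_right, ← hsup, f.injective.eq_iff, sup_eq_right]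

/-- The number `1` as an element of `D ξ`. -/
noncomputable def one (ξ : ℝ) : D ξ := param ξ (1, 0)

/-- The number `ξ` as an element of `D ξ`. -/
noncomputable def gen (ξ : ℝ) : D ξ := param ξ (0, 1)

@[simp] theorem coe_one (ξ : ℝ) : (one ξ : ℝ) = 1 := by simp [one, eval_apply]

@[simp] theorem coe_gen (ξ : ℝ) : (gen ξ : ℝ) = ξ := by simp [gen, eval_apply]

/-- An isomorphism of ordered groups between `D ξ` and `D η` is multiplication by a real number. -/
theorem gen_eq_div (f : D ξ ≃+o D η) : ξ = (f (gen ξ) : ℝ) / (f (one ξ) : ℝ) := by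
  have hmono : StrictMono f := f.toOrderIso.strictMono
  have h1 : (0 : ℝ) < f (one ξ) := by
    have : f 0 < f (one ξ) := hmono (by rw [← Subtype.coe_lt_coe]; simp)
    rw [map_zero] at this
    exact_mod_cast this
  -- Comparing a rational a/b with ξ is comparing a·1 with b·ξ inside D(ξ), which f preserves; both
  -- sides of the goal thus have the same rational cut.
  have key : ∀ a b c d : ℤ, a • one ξ + b • gen ξ < c • one ξ + d • gen ξ →
      a * (f (one ξ) : ℝ) + b * (f (gen ξ) : ℝ) < c * (f (one ξ) : ℝ) + d * (f (gen ξ) : ℝ) := by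
    intro a b c d h
    have := hmono h
    rw [map_add, map_add, map_zsmul, map_zsmul, map_zsmul, map_zsmul, ← Subtype.coe_lt_coe] at this
    simpa using this
  refine le_antisymm ?_ ?_
  · refine le_of_forall_rat_lt_imp_le fun q hq => ?_
    have hd : (0 : ℝ) < q.den := by exact_mod_cast q.pos
    have := key q.num 0 0 q.den (by
      rw [← Subtype.coe_lt_coe]
      rw [Rat.cast_def, div_lt_iff₀ hd] at hq
      simpa [mul_comm] using hq)
    rw [Rat.cast_def, div_le_div_iff₀ hd h1]
    push_cast at this
    linarith
  · refine le_of_forall_lt_rat_imp_le fun q hq => ?_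
    have hd : (0 : ℝ) < q.den := by exact_mod_cast q.pos
    have := key 0 q.den q.num 0 (by
      rw [← Subtype.coe_lt_coe]
      rw [Rat.cast_def, lt_div_iff₀ hd] at hq
      simpa [mul_comm] using hq)
    rw [Rat.cast_def, div_le_div_iff₀ h1 hd]
    push_cast at this
    linarith

theorem countable_setOf_iso (η : ℝ) : {ξ : ℝ | Nonempty (D ξ ≃+o D η)}.Countable := by
  refine (Set.countable_range fun r : (ℤ × ℤ) × (ℤ × ℤ) => eval η r.1 / eval η r.2).mono ?_
  rintro ξ ⟨f⟩
  obtain ⟨p, hp⟩ := param_surjective η (f (gen ξ))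
  obtain ⟨q, hq⟩ := param_surjective η (f (one ξ))
  refine ⟨(p, q), ?_⟩
  conv_rhs => rw [gen_eq_div f, ← hp, ← hq]
  rfl

/-- Isomorphism of the ordered groups `D ξ`, as an equivalence relation on the irrationals. -/
def isoSetoid : Setoid {ξ : ℝ // Irrational ξ} where
  r ξ η := Nonempty (D ξ.1 ≃+o D η.1)
  iseqv := ⟨fun _ => ⟨OrderAddMonoidIso.refl _⟩, fun ⟨f⟩ => ⟨f.symm⟩, fun ⟨f⟩ ⟨g⟩ => ⟨f.trans g⟩⟩

theorem exists_transversal : ∃ X : Set ℝ, (∀ ξ ∈ X, Irrational ξ) ∧ ¬ X.Countable ∧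
    (∀ ξ ∈ X, ∀ η ∈ X, ξ ≠ η → IsEmpty (D ξ ≃+o D η) ∧ IsEmpty (lgroupLang.Equiv (D ξ) (D η))) ∧
    (∀ η : ℝ, Irrational η → ∃ ξ ∈ X, Nonempty (D η ≃+o D ξ)) := by
  let X : Set ℝ := Set.range fun a : Quotient isoSetoid => (a.out : ℝ)
  have hrep : ∀ η : ℝ, Irrational η → ∃ ξ ∈ X, Nonempty (D η ≃+o D ξ) := fun η hη =>
    ⟨_, ⟨Quotient.mk isoSetoid ⟨η, hη⟩, rfl⟩,
      isoSetoid.symm (Quotient.mk_out (s := isoSetoid) ⟨η, hη⟩)⟩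
  have hiso : ∀ ξ ∈ X, ∀ η ∈ X, ξ ≠ η → IsEmpty (D ξ ≃+o D η) := by
    rintro _ ⟨a, rfl⟩ _ ⟨b, rfl⟩ hne
    refine ⟨fun f => hne ?_⟩
    have : a = b := Quotient.out_equiv_out.1 ⟨f⟩
    rw [this]
  refine ⟨X, ?_, fun hX => ?_, fun ξ hξ η hη hne => ⟨hiso ξ hξ η hη hne, ⟨fun f => ?_⟩⟩, hrep⟩
  · rintro _ ⟨a, rfl⟩
    exact a.out.2
  -- A countable X would cover the irrationals by countably many countable classes.
  · have hirr : {η : ℝ | Irrational η}.Countable := by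
      refine (hX.biUnion fun ξ _ => countable_setOf_iso ξ).mono fun η hη => ?_
      simpa using hrep η hη
    refine Set.not_countable_univ (α := ℝ)
      ((hirr.union (Set.countable_range ((↑) : ℚ → ℝ))).mono fun r _ => ?_)
    exact (em (Irrational r)).imp id fun h => not_not.1 h
  · exact (nonempty_orderAddMonoidIso_of_lgroupEquiv f).elim (hiso ξ hξ η hη hne).false

/-! ### Finite generation and countable languages -/

/-- `D ξ` is generated by `1` and `ξ` as a lattice-ordered group. -/
theorem fg_lgroup (ξ : ℝ) : Structure.FG lgroupLang (D ξ) := by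
  rw [Structure.fg_iff]
  refine ⟨{one ξ, gen ξ}, by simp, ?_⟩
  rw [eq_top_iff]
  set S := Substructure.closure lgroupLang {one ξ, gen ξ}
  let A : AddSubgroup (D ξ) :=
    { carrier := S
      add_mem' := fun {a b} ha hb =>
        S.fun_mem (LGroupFunc.add : lgroupLang.Functions 2) ![a, b]
          (by intro i; fin_cases i <;> assumption)
      zero_mem' := S.fun_mem (LGroupFunc.zero : lgroupLang.Functions 0) ![] (fun i => i.elim0)
      neg_mem' := fun {a} ha =>
        S.fun_mem (LGroupFunc.neg : lgroupLang.Functions 1) ![a]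
          (by intro i; fin_cases i; assumption) }
  have h1 : one ξ ∈ A := Substructure.subset_closure (by simp)
  have h2 : gen ξ ∈ A := Substructure.subset_closure (by simp)
  rintro ⟨_, m, k, rfl⟩ -
  have : m • one ξ + k • gen ξ ∈ A := A.add_mem (A.zsmul_mem h1 m) (A.zsmul_mem h2 k)
  have h : (⟨m + k * ξ, m, k, rfl⟩ : D ξ) = m • one ξ + k • gen ξ := by
    ext
    simp
  rw [h]
  exact this

instance : Countable ogroupLang.Symbols := by
  have h1 : Countable (Σ l, OGroupFunc l) :=
    (Function.Injective.countable (β := ℕ)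
      (f := fun s : Σ l, OGroupFunc l => s.1) (by
        rintro ⟨_, a⟩ ⟨_, b⟩ h; cases a <;> cases b <;> simp_all))
  have h2 : Countable (Σ l, OGroupRel l) :=
    (Function.Injective.countable (β := ℕ)
      (f := fun s : Σ l, OGroupRel l => s.1) (by
        rintro ⟨_, a⟩ ⟨_, b⟩ h; cases a; cases b; rfl))
  exact instCountableSum (α := Σ l, OGroupFunc l) (β := Σ l, OGroupRel l)

instance : Countable lgroupLang.Symbols := by
  have h1 : ∀ l, Countable (LGroupFunc l) := fun l =>
    Function.Injective.countable (β := ℕ)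
      (f := fun s : LGroupFunc l => match s with
        | .add => 0 | .neg => 1 | .zero => 2 | .sup => 3 | .inf => 4) (by
        intro a b h; cases a <;> cases b <;> simp_all)
  exact instCountableSum (α := Σ l, LGroupFunc l) (β := Σ _ : ℕ, Empty)

end OrderedGroups

theorem mainTheorem3 :
    -- `D(ξ) = ℤ ⊕ ℤξ` is a two-generator, dense, totally ordered abelian group
    (∀ ξ : ℝ, Irrational ξ →
      (∀ x ∈ OrderedGroups.D ξ, ∃! p : ℤ × ℤ, x = p.1 + p.2 * ξ) ∧
      AddSubgroup.closure {1, ξ} = OrderedGroups.D ξ ∧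
      Dense (OrderedGroups.D ξ : Set ℝ) ∧
      DenselyOrdered (OrderedGroups.D ξ) ∧
      IsOrderedAddMonoid (OrderedGroups.D ξ)) ∧
    -- both languages are countable
    Countable OrderedGroups.ogroupLang.Symbols ∧
    Countable OrderedGroups.lgroupLang.Symbols ∧
    -- all `D(ξ)` are elementarily equivalent, as ordered groups and as lattice-ordered groups
    (∀ ξ η : ℝ, Irrational ξ → Irrational η →
      OrderedGroups.ogroupLang.ElementarilyEquivalent
        (OrderedGroups.D ξ) (OrderedGroups.D η) ∧
      OrderedGroups.lgroupLang.ElementarilyEquivalent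
        (OrderedGroups.D ξ) (OrderedGroups.D η)) ∧
    -- up to isomorphism, the `D(ξ)` form an uncountable family
    (∃ X : Set ℝ, (∀ ξ ∈ X, Irrational ξ) ∧ ¬ X.Countable ∧
      (∀ ξ ∈ X, ∀ η ∈ X, ξ ≠ η →
        IsEmpty (OrderedGroups.D ξ ≃+o OrderedGroups.D η) ∧
        IsEmpty (OrderedGroups.lgroupLang.Equiv (OrderedGroups.D ξ) (OrderedGroups.D η))) ∧
      (∀ η : ℝ, Irrational η → ∃ ξ ∈ X,
        Nonempty (OrderedGroups.D η ≃+o OrderedGroups.D ξ))) ∧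
    -- finitely generated, elementarily equivalent abelian lattice-ordered groups need not be
    -- isomorphic
    (¬ ∀ (G H : Type) [AddCommGroup G] [Lattice G] [IsOrderedAddMonoid G]
        [AddCommGroup H] [Lattice H] [IsOrderedAddMonoid H],
        FirstOrder.Language.Structure.FG OrderedGroups.lgroupLang G →
        FirstOrder.Language.Structure.FG OrderedGroups.lgroupLang H →
        OrderedGroups.lgroupLang.ElementarilyEquivalent G H →
        Nonempty (OrderedGroups.lgroupLang.Equiv G H)) := by
  open OrderedGroups in
  refine ⟨fun ξ hξ => ⟨?_, closure_eq ξ, dense_D hξ, ⟨?_⟩, inferInstance⟩, inferInstance,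
    inferInstance, fun ξ η hξ hη =>
      ⟨elementarilyEquivalent_ogroup hξ hη, elementarilyEquivalent_lgroup hξ hη⟩,
    exists_transversal, fun h => ?_⟩
  · rintro x ⟨m, n, rfl⟩
    exact ⟨(m, n), rfl, fun p hp => OrderedGroups.eval_injective hξ hp.symm⟩
  · intro a b hab
    obtain ⟨c, hc, h1, h2⟩ := (OrderedGroups.dense_D hξ).exists_between hab
    exact ⟨⟨c, hc⟩, h1, h2⟩
  · obtain ⟨X, hirr, hX, hiso, -⟩ := OrderedGroups.exists_transversal
    have hnt : X.Nontrivial := by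
      rw [← Set.not_subsingleton_iff]
      exact fun hs => hX hs.countable
    obtain ⟨ξ, hξ, η, hη, hne⟩ := hnt
    obtain ⟨f⟩ := h (OrderedGroups.D ξ) (OrderedGroups.D η) (OrderedGroups.fg_lgroup ξ)
      (OrderedGroups.fg_lgroup η)
      (OrderedGroups.elementarilyEquivalent_lgroup (hirr ξ hξ) (hirr η hη))
    exact (hiso ξ hξ η hη hne).2.false f
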